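/- Let $\Sigma$ be a finite set with at least two elements $\mathbf{0}\neq\mathbf{1}$, and let $\Sigma^{<\mathrm{Ord}}$ be the class of all functions $w$ whose domain is an ordinal and whose values lie in $\Sigma$. For a set $x$, let $\mathrm{L}[x]=\bigcup_{\alpha\in\mathrm{Ord}}\mathrm{L}_\alpha[x]$ be the class of sets constructible relative to $x$, where $\mathrm{L}_0[x]=\varnothing$, $\mathrm{L}_{\alpha+1}[x]$ is the set of all subsets of $M=\mathrm{L}_\alpha[x]$ that are first-order definable with parameters over the structure $(M,\in,x\cap M)$, and $\mathrm{L}_\lambda[x]=\bigcup_{\alpha<\lambda}\mathrm{L}_\alpha[x]$ for limit ordinals $\lambda$. Lemma. If $x$ is a set of ordinals and $\Sigma^{<\mathrm{Ord}}\subseteq\mathrm{L}[x]$, then $\mathrm{V}=\mathrm{L}[x]$, where $\mathrm{V}$ is the class of all sets. -/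

import Mathlib

/-!
The universe `V` of all sets is Mathlib's type `ZFSet.{u}`; classes are `Set ZFSet.{u}`;
ordinals as elements of `V` are von Neumann ordinals (`ZFSet.IsOrdinal`).
-/

universe u

namespace RelConstr

/-- Relation symbols of the language `{∈, P}` of set theory with one additional unary predicate. -/
inductive SetRel : ℕ → Type
  | pred : SetRel 1
  | mem : SetRel 2

/-- The first-order language of set theory with one additional unary predicate `P`. -/
abbrev setLang : FirstOrder.Language.{0, 0} where
  Functions := fun _ => Empty
  Relations := SetRel

/-- The structure `(M, ∈, x ∩ M)`. -/
@[reducible] def setStructure (x M : ZFSet.{u}) : setLang.Structure M where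
  funMap := fun f => f.elim
  RelMap := fun r v =>
    match r, v with
    | SetRel.pred, v => (v 0 : ZFSet.{u}) ∈ x
    | SetRel.mem, v => (v 0 : ZFSet.{u}) ∈ (v 1 : ZFSet.{u})

/-- `def_x(M)`: the set of all subsets of `M` that are first-order definable, with parameters
from `M`, over the structure `(M, ∈, x ∩ M)`. -/
noncomputable def definablePowerset (x M : ZFSet.{u}) : ZFSet.{u} :=
  ZFSet.sep
    (fun Y =>
      letI := setStructure x M
      (Set.univ : Set M).Definable₁ setLang {m : M | (m : ZFSet.{u}) ∈ Y})
    M.powerset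

/-- The hierarchy of sets constructible relative to `x`: `L_0[x] = ∅`,
`L_{α+1}[x] = def_x(L_α[x])`, and `L_α[x] = ⋃_{β<α} L_β[x]` for limit ordinals `α`. -/
noncomputable def level (x : ZFSet.{u}) (α : Ordinal.{u}) : ZFSet.{u} :=
  Ordinal.limitRecOn (motive := fun _ => ZFSet.{u}) α
    ∅
    (fun _ M => definablePowerset x M)
    (fun α _ ih => ZFSet.iUnion fun β : Set.Iio α => ih β.1 β.2)

/-- The class `L[x]` of all sets constructible relative to `x`. -/
def L (x : ZFSet.{u}) : Set ZFSet.{u} :=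
  {y | ∃ α : Ordinal.{u}, y ∈ level x α}

/-- The class `S^{<Ord}` of all functions (as sets of Kuratowski pairs) with values in `S` whose
domain is an ordinal. -/
def SeqLtOrd (S : ZFSet.{u}) : Set ZFSet.{u} :=
  {w | ∃ α : ZFSet.{u}, α.IsOrdinal ∧ ZFSet.IsFunc α S w}

end RelConstr

/-!
A set `s` of ordinals is read off from its characteristic sequence, so the hypothesis puts every set
of ordinals into `L[x]`. It remains to recover an arbitrary set `y` from sets of ordinals. Enumerate
a transitive set containing `y` by a set `D` of ordinals; then `y` is a value of the Mostowski
collapse of a relation `E ⊆ D × D`.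

The collapse of a relation `R ∈ L[x]` stays inside `L[x]`: restricted to a set in `L[x]`, its graph
lies in a bisimulation between `R` and `∈`, and being such a bisimulation is a `Δ₀` property, hence
definable over all late levels of `L[x]`. This is used twice: collapsing the lexicographic
well-order of `D × D` identifies the subset `E` with a set of ordinals, which gives `E ∈ L[x]`, and
collapsing `E` then gives `y ∈ L[x]`.
-/

namespace RelConstr

open Filter ZFSet

section Definability

variable {x M : ZFSet.{u}} {α : Type}

/-- `P` is definable with parameters over the structure `(M, ∈, x ∩ M)`. -/
def DefinableOver (x M : ZFSet.{u}) (P : (α → ZFSet.{u}) → Prop) : Prop :=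
  letI := setStructure x M
  (Set.univ : Set M).Definable setLang {v : α → M | P fun i => v i}

/-- The terms of the language of set theory with parameters from the class `C`, identified with the
functions of the valuation that they denote: variables and constants. -/
inductive IsTerm (C : Set ZFSet.{u}) : ((α → ZFSet.{u}) → ZFSet.{u}) → Prop
  | var (i : α) : IsTerm C fun v => v i
  | const {c : ZFSet.{u}} (hc : c ∈ C) : IsTerm C fun _ => c

namespace IsTerm

variable {C : Set ZFSet.{u}} {t : (α → ZFSet.{u}) → ZFSet.{u}}

theorem comp {β : Type} (ht : IsTerm C t) (g : α → β) :
    IsTerm C fun v : β → ZFSet.{u} => t fun i => v (g i) := by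
  cases ht with
  | var i => exact .var (g i)
  | const hc => exact .const hc

theorem apply_mem (ht : IsTerm C t) {v : α → ZFSet.{u}} (hv : ∀ i, v i ∈ C) : t v ∈ C := by
  cases ht with
  | var i => exact hv i
  | const hc => exact hc

theorem exists_term (ht : IsTerm (M : Set ZFSet.{u}) t) :
    letI := setStructure x M
    ∃ τ : setLang.Term ((Set.univ : Set M) ⊕ α),
      ∀ v : α → M, t (fun i => v i) = (τ.realize (Sum.elim (↑) v) : M) := by
  cases ht with
  | var i => exact ⟨.var (.inr i), fun _ => rfl⟩
  | @const c hc => exact ⟨.var (.inl ⟨⟨c, hc⟩, trivial⟩), fun _ => rfl⟩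

end IsTerm

theorem DefinableOver.mem {s t : (α → ZFSet.{u}) → ZFSet.{u}}
    (hs : IsTerm (M : Set ZFSet.{u}) s) (ht : IsTerm (M : Set ZFSet.{u}) t) :
    DefinableOver x M fun v => s v ∈ t v := by
  let := setStructure x M
  obtain ⟨σ, hσ⟩ := hs.exists_term (x := x)
  obtain ⟨τ, hτ⟩ := ht.exists_term (x := x)
  refine Set.definable_iff_exists_formula_sum.2
    ⟨FirstOrder.Language.Relations.formula₂ (L := setLang) SetRel.mem σ τ, Set.ext fun v => ?_⟩
  change s (fun i => v i) ∈ t (fun i => v i) ↔ FirstOrder.Language.Formula.Realize _ _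
  rw [hσ, hτ, FirstOrder.Language.Formula.realize_rel₂]
  rfl

end Definability

section Levels

variable {x M : ZFSet.{u}}

theorem mem_definablePowerset {Y : ZFSet.{u}} : Y ∈ definablePowerset x M ↔
    Y ⊆ M ∧ DefinableOver x M fun v : Fin 1 → ZFSet.{u} => v 0 ∈ Y := by
  rw [definablePowerset, mem_sep, mem_powerset]
  rfl

theorem subset_definablePowerset (hM : M.IsTransitive) : M ⊆ definablePowerset x M := fun y hy =>
  mem_definablePowerset.2 ⟨hM y hy, .mem (.var 0) (.const hy)⟩

theorem self_mem_definablePowerset : M ∈ definablePowerset x M := by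
  let := setStructure x M
  refine mem_definablePowerset.2 ⟨fun _ h => h, ?_⟩
  have hM : {v : Fin 1 → M | (v 0 : ZFSet.{u}) ∈ M} = Set.univ :=
    Set.eq_univ_of_forall fun v => (v 0).2
  rw [DefinableOver, hM]
  exact Set.definable_univ

variable (x) in
theorem level_zero : level x 0 = ∅ := Ordinal.limitRecOn_zero ..

variable (x) in
theorem level_add_one (o : Ordinal.{u}) : level x (o + 1) = definablePowerset x (level x o) :=
  Ordinal.limitRecOn_add_one ..

theorem mem_level_limit {o : Ordinal.{u}} (ho : Order.IsSuccLimit o) {y : ZFSet.{u}} :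
    y ∈ level x o ↔ ∃ b < o, y ∈ level x b := by
  rw [level, Ordinal.limitRecOn_limit _ _ _ _ ho, mem_iUnion]
  exact Subtype.exists.trans (by simp only [Set.mem_Iio, exists_prop, level])

variable (x) in
theorem isTransitive_level (o : Ordinal.{u}) : (level x o).IsTransitive := by
  induction o using Ordinal.limitRecOn with
  | zero => exact level_zero x ▸ isTransitive_empty
  | add_one o ih =>
    rw [level_add_one]
    exact fun Y hY y hy => subset_definablePowerset ih ((mem_definablePowerset.1 hY).1 hy)
  | limit o ho ih =>
    intro y hy z hz
    obtain ⟨b, hb, h⟩ := (mem_level_limit ho).1 hy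
    exact (mem_level_limit ho).2 ⟨b, hb, ih b hb _ h hz⟩

variable (x) in
theorem level_mono : Monotone (level x) := by
  intro a b hab
  induction b using Ordinal.limitRecOn with
  | zero => rw [nonpos_iff_eq_zero.1 hab]
  | add_one b ih =>
    rcases hab.eq_or_lt with rfl | h
    · rfl
    · rw [level_add_one]
      exact (ih (Order.lt_add_one_iff.1 h)).trans
        (subset_definablePowerset (isTransitive_level x b))
  | limit b hb ih =>
    rcases hab.eq_or_lt with rfl | h
    · rfl
    · exact fun y hy => (mem_level_limit hb).2 ⟨a, h, hy⟩

variable (x) in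
theorem level_mem_L (o : Ordinal.{u}) : level x o ∈ L x :=
  ⟨o + 1, level_add_one x o ▸ self_mem_definablePowerset⟩

theorem mem_L_of_mem {y z : ZFSet.{u}} (hy : y ∈ L x) (hz : z ∈ y) : z ∈ L x :=
  hy.imp fun o ho => isTransitive_level x o _ ho hz

theorem mem_of_pair_mem (hM : M.IsTransitive) {a b : ZFSet.{u}} (h : pair a b ∈ M) :
    a ∈ M ∧ b ∈ M := by
  have hab : ({a, b} : ZFSet.{u}) ∈ M := hM _ h (by simp [pair])
  exact ⟨hM _ hab (by simp), hM _ hab (by simp)⟩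

theorem mem_L_of_pair_mem {a b : ZFSet.{u}} (h : pair a b ∈ L x) : a ∈ L x ∧ b ∈ L x := by
  obtain ⟨o, ho⟩ := h
  exact (mem_of_pair_mem (isTransitive_level x o) ho).imp (⟨o, ·⟩) (⟨o, ·⟩)

theorem eventually_forall_mem_level {ι : Type*} [Small.{u} ι] {f : ι → ZFSet.{u}}
    (hf : ∀ i, f i ∈ L x) : ∀ᶠ o in atTop, ∀ i, f i ∈ level x o := by
  choose g hg using hf
  filter_upwards [eventually_ge_atTop (⨆ i, g i)] with o ho i
  exact level_mono x ((Ordinal.le_iSup g i).trans ho) (hg i)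

theorem eventually_mem_level {y : ZFSet.{u}} (hy : y ∈ L x) : ∀ᶠ o in atTop, y ∈ level x o :=
  (eventually_forall_mem_level (ι := Unit) fun _ => hy).mono fun _ h => h ()

end Levels

section Absoluteness

variable {x : ZFSet.{u}} {α : Type}

/-- `P` is definable with parameters over all sufficiently late levels of `L[x]`. The defining
formula may depend on the level, but every `Δ₀` predicate with parameters in `L[x]` qualifies,
because the levels are transitive. -/
def EventuallyDefinable (x : ZFSet.{u}) (P : (α → ZFSet.{u}) → Prop) : Prop :=
  ∀ᶠ o in atTop, DefinableOver x (level x o) P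

theorem IsTerm.eventually_level {t : (α → ZFSet.{u}) → ZFSet.{u}} (ht : IsTerm (L x) t) :
    ∀ᶠ o in atTop, IsTerm (level x o : Set ZFSet.{u}) t := by
  cases ht with
  | var i => exact .of_forall fun _ => .var i
  | const hc => exact (eventually_mem_level hc).mono fun _ h => .const h

namespace EventuallyDefinable

variable {P P' : (α → ZFSet.{u}) → Prop}

theorem congr (hP : EventuallyDefinable x P) (h : ∀ v, P' v ↔ P v) : EventuallyDefinable x P' :=
  (funext fun v => propext (h v) : P' = P) ▸ hP

theorem and (hP : EventuallyDefinable x P) (hP' : EventuallyDefinable x P') :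
    EventuallyDefinable x fun v => P v ∧ P' v := by
  filter_upwards [hP, hP'] with o ho ho'
  exact letI := setStructure x (level x o); Set.Definable.inter ho ho'

theorem not (hP : EventuallyDefinable x P) : EventuallyDefinable x fun v => ¬ P v := by
  filter_upwards [hP] with o ho
  exact letI := setStructure x (level x o); Set.Definable.compl ho

theorem or (hP : EventuallyDefinable x P) (hP' : EventuallyDefinable x P') :
    EventuallyDefinable x fun v => P v ∨ P' v :=
  (hP.not.and hP'.not).not.congr fun _ => or_iff_not_and_not

variable {r s t : (α → ZFSet.{u}) → ZFSet.{u}} {Q : (α → ZFSet.{u}) → ZFSet.{u} → Prop}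

theorem mem (hs : IsTerm (L x) s) (ht : IsTerm (L x) t) :
    EventuallyDefinable x fun v => s v ∈ t v := by
  filter_upwards [hs.eventually_level, ht.eventually_level] with o hs ht
  exact .mem hs ht

theorem exists_of_bounded
    (hQ : EventuallyDefinable x fun v : α ⊕ Unit → ZFSet.{u} =>
      Q (fun i => v (.inl i)) (v (.inr ())))
    (hz : ∀ᶠ o in atTop, ∀ v, (∀ i, v i ∈ level x o) → ∀ z, Q v z → z ∈ level x o) :
    EventuallyDefinable x fun v => ∃ z, Q v z := by
  filter_upwards [hQ, hz] with o ho hz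
  let := setStructure x (level x o)
  have hset : {v : α → level x o | ∃ z, Q (fun i => v i) z} =
      {v | ∃ z : Unit → level x o, Q (fun i => v i) (z ())} := by
    ext v
    exact ⟨fun ⟨z, h⟩ => ⟨fun _ => ⟨z, hz _ (fun i => (v i).2) z h⟩, h⟩, fun ⟨z, h⟩ => ⟨_, h⟩⟩
  rw [DefinableOver, hset]
  exact Set.Definable.exists_of_finite ho

theorem exists_mem (ht : IsTerm (L x) t)
    (hQ : EventuallyDefinable x fun v : α ⊕ Unit → ZFSet.{u} =>
      Q (fun i => v (.inl i)) (v (.inr ()))) :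
    EventuallyDefinable x fun v => ∃ z ∈ t v, Q v z := by
  refine exists_of_bounded ((mem (.var _) (ht.comp _)).and hQ) ?_
  filter_upwards [ht.eventually_level] with o ht v hv z hz
  exact isTransitive_level x o _ (ht.apply_mem hv) hz.1

theorem forall_mem (ht : IsTerm (L x) t)
    (hQ : EventuallyDefinable x fun v : α ⊕ Unit → ZFSet.{u} =>
      Q (fun i => v (.inl i)) (v (.inr ()))) :
    EventuallyDefinable x fun v => ∀ z ∈ t v, Q v z :=
  (exists_mem (Q := fun v z => ¬ Q v z) ht hQ.not).not.congr fun v => by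
    simp only [not_exists, not_and, not_not]

theorem eq (hs : IsTerm (L x) s) (ht : IsTerm (L x) t) :
    EventuallyDefinable x fun v => s v = t v := by
  have hsub {s t : (α → ZFSet.{u}) → ZFSet.{u}} (hs : IsTerm (L x) s) (ht : IsTerm (L x) t) :
      EventuallyDefinable x fun v => ∀ z ∈ s v, z ∈ t v :=
    forall_mem hs (mem (.var _) (ht.comp _))
  exact ((hsub hs ht).and (hsub ht hs)).congr fun v => by
    rw [ZFSet.ext_iff]
    grind

theorem eq_insert_singleton (hr : IsTerm (L x) r) (hs : IsTerm (L x) s) (ht : IsTerm (L x) t) :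
    EventuallyDefinable x fun v => r v = {s v, t v} := by
  have h : EventuallyDefinable x fun v =>
      s v ∈ r v ∧ t v ∈ r v ∧ ∀ z ∈ r v, z = s v ∨ z = t v :=
    (mem hs hr).and ((mem ht hr).and (forall_mem hr
      ((eq (.var _) (hs.comp _)).or (eq (.var _) (ht.comp _)))))
  refine h.congr fun v => ?_
  simp only [ZFSet.ext_iff (x := r v), mem_pair]
  grind

theorem eq_singleton (hr : IsTerm (L x) r) (hs : IsTerm (L x) s) :
    EventuallyDefinable x fun v => r v = {s v} :=
  (eq_insert_singleton hr hs hs).congr fun v => by rw [pair_eq_singleton]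

theorem eq_pair (hr : IsTerm (L x) r) (hs : IsTerm (L x) s) (ht : IsTerm (L x) t) :
    EventuallyDefinable x fun v => r v = pair (s v) (t v) := by
  have h : EventuallyDefinable x fun v => (∃ z ∈ r v, z = {s v}) ∧ (∃ z ∈ r v, z = {s v, t v}) ∧
      ∀ z ∈ r v, z = {s v} ∨ z = {s v, t v} :=
    (exists_mem hr (eq_singleton (.var _) (hs.comp _))).and
      ((exists_mem hr (eq_insert_singleton (.var _) (hs.comp _) (ht.comp _))).and
      (forall_mem hr ((eq_singleton (.var _) (hs.comp _)).or
        (eq_insert_singleton (.var _) (hs.comp _) (ht.comp _)))))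
  refine h.congr fun v => ?_
  simp only [exists_eq_right, ZFSet.ext_iff (x := r v), pair, mem_pair]
  grind

theorem pair_mem (hs : IsTerm (L x) s) (ht : IsTerm (L x) t) (hr : IsTerm (L x) r) :
    EventuallyDefinable x fun v => pair (s v) (t v) ∈ r v := by
  have h : EventuallyDefinable x fun v => ∃ p ∈ r v, p = pair (s v) (t v) :=
    exists_mem hr (eq_pair (.var _) (hs.comp _) (ht.comp _))
  exact h.congr fun v => by simp only [exists_eq_right]

theorem exists_pair_left (hs : IsTerm (L x) s) (hr : IsTerm (L x) r)
    (hQ : EventuallyDefinable x fun v : α ⊕ Unit → ZFSet.{u} =>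
      Q (fun i => v (.inl i)) (v (.inr ()))) :
    EventuallyDefinable x fun v => ∃ a, pair a (s v) ∈ r v ∧ Q v a := by
  refine exists_of_bounded ((pair_mem (.var _) (hs.comp _) (hr.comp _)).and hQ) ?_
  filter_upwards [hr.eventually_level] with o hr v hv a ha
  have htrans := isTransitive_level x o
  exact (mem_of_pair_mem htrans (htrans _ (hr.apply_mem hv) ha.1)).1

theorem forall_pair_left (hs : IsTerm (L x) s) (hr : IsTerm (L x) r)
    (hQ : EventuallyDefinable x fun v : α ⊕ Unit → ZFSet.{u} =>
      Q (fun i => v (.inl i)) (v (.inr ()))) :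
    EventuallyDefinable x fun v => ∀ a, pair a (s v) ∈ r v → Q v a :=
  (exists_pair_left (Q := fun v a => ¬ Q v a) hs hr hQ.not).not.congr fun v => by
    simp only [not_exists, not_and, not_not]

theorem forall_pair {Q : (α → ZFSet.{u}) → ZFSet.{u} → ZFSet.{u} → Prop} (hr : IsTerm (L x) r)
    (hQ : EventuallyDefinable x fun v : (α ⊕ Unit) ⊕ Unit → ZFSet.{u} =>
      Q (fun i => v (.inl (.inl i))) (v (.inl (.inr ()))) (v (.inr ()))) :
    EventuallyDefinable x fun v => ∀ b z, pair b z ∈ r v → Q v b z := by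
  have htrans := isTransitive_level x
  have h₁ : EventuallyDefinable x fun v : α ⊕ Unit → ZFSet.{u} => ∃ z,
      pair (v (.inr ())) z ∈ r (fun i => v (.inl i)) ∧
        ¬ Q (fun i => v (.inl i)) (v (.inr ())) z := by
    refine exists_of_bounded (α := α ⊕ Unit)
      (Q := fun v z => pair (v (.inr ())) z ∈ r (fun i => v (.inl i)) ∧
        ¬ Q (fun i => v (.inl i)) (v (.inr ())) z)
      ((pair_mem (.var _) (.var _) ((hr.comp _).comp _)).and hQ.not) ?_
    filter_upwards [hr.eventually_level] with o hr v hv z hz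
    exact (mem_of_pair_mem (htrans o) (htrans o _ (hr.apply_mem fun i => hv _) hz.1)).2
  have h₂ : EventuallyDefinable x fun v => ∃ b z, pair b z ∈ r v ∧ ¬ Q v b z := by
    refine exists_of_bounded (Q := fun v b => ∃ z, pair b z ∈ r v ∧ ¬ Q v b z) h₁ ?_
    filter_upwards [hr.eventually_level] with o hr v hv b ⟨z, hz, _⟩
    exact (mem_of_pair_mem (htrans o) (htrans o _ (hr.apply_mem hv) hz)).1
  exact h₂.not.congr fun v => by grind

end EventuallyDefinable

end Absoluteness

section Closure

variable {x : ZFSet.{u}} {a b s : ZFSet.{u}}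

theorem mem_L_of_eventuallyDefinable (hs : ∀ z ∈ s, z ∈ L x)
    (h : EventuallyDefinable x fun v : Fin 1 → ZFSet.{u} => v 0 ∈ s) : s ∈ L x := by
  obtain ⟨o, hso, ho⟩ := ((eventually_forall_mem_level fun z : s => hs z z.2).and h).exists
  exact ⟨o + 1, level_add_one x o ▸ mem_definablePowerset.2 ⟨fun z hz => hso ⟨z, hz⟩, ho⟩⟩

theorem sep_mem_L {p : ZFSet.{u} → Prop} (ha : a ∈ L x)
    (hp : EventuallyDefinable x fun v : Fin 1 → ZFSet.{u} => p (v 0)) : a.sep p ∈ L x :=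
  mem_L_of_eventuallyDefinable (fun _ hz => mem_L_of_mem ha (mem_sep.1 hz).1)
    (((EventuallyDefinable.mem (.var 0) (.const ha)).and hp).congr fun _ => mem_sep)

variable (x) in
theorem empty_mem_L : ∅ ∈ L x := level_zero x ▸ level_mem_L x 0

theorem sUnion_mem_L (ha : a ∈ L x) : ⋃₀ a ∈ L x := by
  have h : EventuallyDefinable x fun v : Fin 1 → ZFSet.{u} => ∃ y ∈ a, v 0 ∈ y :=
    .exists_mem (.const ha) (.mem (.var _) (.var _))
  refine mem_L_of_eventuallyDefinable (fun z hz => ?_) (h.congr fun _ => mem_sUnion)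
  obtain ⟨y, hy, hzy⟩ := mem_sUnion.1 hz
  exact mem_L_of_mem (mem_L_of_mem ha hy) hzy

theorem insert_mem_L (ha : a ∈ L x) (hs : s ∈ L x) : insert a s ∈ L x := by
  have h : EventuallyDefinable x fun v : Fin 1 → ZFSet.{u} => v 0 = a ∨ v 0 ∈ s :=
    (EventuallyDefinable.eq (.var _) (.const ha)).or (.mem (.var _) (.const hs))
  refine mem_L_of_eventuallyDefinable (fun z hz => ?_) (h.congr fun _ => mem_insert_iff)
  rcases mem_insert_iff.1 hz with rfl | hz
  exacts [ha, mem_L_of_mem hs hz]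

theorem singleton_mem_L (ha : a ∈ L x) : {a} ∈ L x :=
  insert_empty_eq (β := ZFSet.{u}) a ▸ insert_mem_L ha (empty_mem_L x)

theorem pair_mem_L (ha : a ∈ L x) (hb : b ∈ L x) : pair a b ∈ L x :=
  insert_mem_L (singleton_mem_L ha) (singleton_mem_L (insert_mem_L ha (singleton_mem_L hb)))

theorem prod_mem_L (ha : a ∈ L x) (hb : b ∈ L x) : prod a b ∈ L x := by
  have h : EventuallyDefinable x fun v : Fin 1 → ZFSet.{u} =>
      ∃ c ∈ a, ∃ d ∈ b, v 0 = pair c d :=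
    .exists_mem (.const ha) (.exists_mem (.const hb) (.eq_pair (.var _) (.var _) (.var _)))
  refine mem_L_of_eventuallyDefinable (fun z hz => ?_) (h.congr fun _ => mem_prod)
  obtain ⟨c, hc, d, hd, rfl⟩ := mem_prod.1 hz
  exact pair_mem_L (mem_L_of_mem ha hc) (mem_L_of_mem hb hd)

end Closure

section Collapse

variable {x R f g b z : ZFSet.{u}} {π : ZFSet.{u} → ZFSet.{u}}

/-- The back-and-forth condition at `(b, z)` for a bisimulation between `R` and `∈`: the relation
`f` matches the `R`-predecessors of `b` with the elements of `z`. -/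
def Matches (R f b z : ZFSet.{u}) : Prop :=
  (∀ a, pair a b ∈ R → ∃ y ∈ z, pair a y ∈ f) ∧ ∀ y ∈ z, ∃ a, pair a b ∈ R ∧ pair a y ∈ f

/-- `f` is a bisimulation between the relation `R` and the membership relation. Sets of pairs with
this property approximate the Mostowski collapse of `R` without mentioning it. -/
def IsBisimulation (R f : ZFSet.{u}) : Prop :=
  ∀ b z, pair b z ∈ f → Matches R f b z

/-- `π` is the Mostowski collapse of the relation `R`, as a map defined on all sets: it is `∅` at
every set without `R`-predecessors. -/
def IsCollapse (R : ZFSet.{u}) (π : ZFSet.{u} → ZFSet.{u}) : Prop :=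
  ∀ b z, z ∈ π b ↔ ∃ a, pair a b ∈ R ∧ π a = z

theorem EventuallyDefinable.isBisimulation {α : Type} {t : (α → ZFSet.{u}) → ZFSet.{u}}
    (hR : R ∈ L x) (ht : IsTerm (L x) t) :
    EventuallyDefinable x fun v => IsBisimulation R (t v) :=
  .forall_pair ht (.and
    (.forall_pair_left (.var _) (.const hR)
      (.exists_mem (.var _) (.pair_mem (.var _) (.var _) ((((ht.comp _).comp _).comp _).comp _))))
    (.forall_mem (.var _)
      (.exists_pair_left (.var _) (.const hR)
        (.pair_mem (.var _) (.var _) ((((ht.comp _).comp _).comp _).comp _)))))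

theorem Matches.mono (h : Matches R f b z) (hfg : f ⊆ g) : Matches R g b z :=
  ⟨fun a ha => (h.1 a ha).imp fun _ => And.imp_right (hfg ·),
    fun y hy => (h.2 y hy).imp fun _ => And.imp_right (hfg ·)⟩

namespace IsBisimulation

theorem sUnion {F : ZFSet.{u}} (hF : ∀ f ∈ F, IsBisimulation R f) : IsBisimulation R (⋃₀ F) := by
  intro b z h
  obtain ⟨f, hf, hbz⟩ := mem_sUnion.1 h
  exact (hF f hf b z hbz).mono fun _ hp => mem_sUnion.2 ⟨f, hf, hp⟩

theorem insert_pair (hf : IsBisimulation R f) (h : Matches R f b z) :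
    IsBisimulation R (insert (pair b z) f) := by
  have hsub : f ⊆ insert (pair b z) f := fun _ => mem_insert_of_mem _
  intro b' z' h'
  rcases mem_insert_iff.1 h' with h' | h'
  · obtain ⟨rfl, rfl⟩ := pair_inj.1 h'
    exact h.mono hsub
  · exact (hf b' z' h').mono hsub

theorem eq_collapse (hf : IsBisimulation R f) (hπ : IsCollapse R π) (h : pair b z ∈ f) :
    z = π b := by
  induction b using (InvImage.wf π mem_wf).induction generalizing z with | _ b ih
  have hmem {a : ZFSet.{u}} (ha : pair a b ∈ R) : π a ∈ π b := (hπ b _).2 ⟨a, ha, rfl⟩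
  ext y
  constructor
  · intro hy
    obtain ⟨a, hab, hay⟩ := (hf b z h).2 y hy
    exact ih a (hmem hab) hay ▸ hmem hab
  · intro hy
    obtain ⟨a, hab, rfl⟩ := (hπ b y).1 hy
    obtain ⟨y, hy, hay⟩ := (hf b z h).1 a hab
    exact ih a (hmem hab) hay ▸ hy

end IsBisimulation

instance small_predecessors (R b : ZFSet.{u}) : Small.{u} {a // pair a b ∈ R} :=
  small_of_injective (f := fun a => (⟨pair a b, a.2⟩ : R)) fun _ _ h =>
    Subtype.ext (pair_inj.1 (Subtype.mk.inj h)).1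

theorem exists_isBisimulation_forall_mem {ι : Type*} [Small.{u} ι] {p : ι → ZFSet.{u}}
    (hR : R ∈ L x) (h : ∀ i, ∃ f ∈ L x, IsBisimulation R f ∧ p i ∈ f) :
    ∃ f ∈ L x, IsBisimulation R f ∧ ∀ i, p i ∈ f := by
  choose f hfL hf hpf using h
  obtain ⟨o, ho⟩ := (eventually_forall_mem_level hfL).exists
  let F := (level x o).sep (IsBisimulation R)
  have hF : F ∈ L x := sep_mem_L (level_mem_L x o) (.isBisimulation hR (.var 0))
  exact ⟨⋃₀ F, sUnion_mem_L hF, .sUnion fun g hg => (mem_sep.1 hg).2,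
    fun i => mem_sUnion.2 ⟨f i, mem_sep.2 ⟨ho i, hf i⟩, hpf i⟩⟩

namespace IsCollapse

theorem exists_isBisimulation_pair_mem (hπ : IsCollapse R π) (hR : R ∈ L x) (hb : b ∈ L x) :
    ∃ f ∈ L x, IsBisimulation R f ∧ pair b (π b) ∈ f := by
  induction b using (InvImage.wf π mem_wf).induction with | _ b ih
  obtain ⟨f, hfL, hf, hpred⟩ := exists_isBisimulation_forall_mem hR
    fun a : {a // pair a b ∈ R} => ih a ((hπ b _).2 ⟨a, a.2, rfl⟩)
      (mem_L_of_pair_mem (mem_L_of_mem hR a.2)).1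
  have hπf {a : ZFSet.{u}} (ha : pair a b ∈ R) : pair a (π a) ∈ f := hpred ⟨a, ha⟩
  have hmatch : Matches R f b (π b) := by
    refine ⟨fun a ha => ⟨π a, (hπ b _).2 ⟨a, ha, rfl⟩, hπf ha⟩, fun y hy => ?_⟩
    obtain ⟨a, ha, rfl⟩ := (hπ b y).1 hy
    exact ⟨a, ha, hπf ha⟩
  have hπb : π b ∈ L x := by
    have h : EventuallyDefinable x fun v : Fin 1 → ZFSet.{u} =>
        ∃ a, pair a b ∈ R ∧ pair a (v 0) ∈ f :=
      .exists_pair_left (.const hb) (.const hR) (.pair_mem (.var _) (.var _) (.const hfL))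
    refine mem_L_of_eventuallyDefinable (fun y hy => ?_) (h.congr fun v => ⟨hmatch.2 _, ?_⟩)
    · obtain ⟨a, -, hay⟩ := hmatch.2 y hy
      exact (mem_L_of_pair_mem (mem_L_of_mem hfL hay)).2
    · rintro ⟨a, hab, hay⟩
      exact (hπ b _).2 ⟨a, hab, (hf.eq_collapse hπ hay).symm⟩
  exact ⟨_, insert_mem_L (pair_mem_L hb hπb) hfL, hf.insert_pair hmatch, mem_insert _ _⟩

theorem apply_mem_L (hπ : IsCollapse R π) (hR : R ∈ L x) (hb : b ∈ L x) : π b ∈ L x := by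
  obtain ⟨f, hf, -, hbf⟩ := hπ.exists_isBisimulation_pair_mem hR hb
  exact (mem_L_of_pair_mem (mem_L_of_mem hf hbf)).2

theorem isOrdinal (hπ : IsCollapse R π)
    (htrans : ∀ a b c, pair a b ∈ R → pair b c ∈ R → pair a c ∈ R) (b : ZFSet.{u}) :
    (π b).IsOrdinal := by
  have hπt (b : ZFSet.{u}) : (π b).IsTransitive := by
    intro y hy z hz
    obtain ⟨c, hcb, rfl⟩ := (hπ b y).1 hy
    obtain ⟨a, hac, rfl⟩ := (hπ c z).1 hz
    exact (hπ b _).2 ⟨a, htrans a c b hac hcb, rfl⟩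
  refine isOrdinal_iff_forall_mem_isTransitive.2 ⟨hπt b, fun y hy => ?_⟩
  obtain ⟨a, -, rfl⟩ := (hπ b y).1 hy
  exact hπt a

theorem injOn {D : Set ZFSet.{u}} (hπ : IsCollapse R π)
    (htri : ∀ a ∈ D, ∀ b ∈ D, pair a b ∈ R ∨ a = b ∨ pair b a ∈ R) : D.InjOn π := by
  intro a ha b hb hab
  rcases htri a ha b hb with h | h | h
  · exact absurd ((hπ b (π a)).2 ⟨a, h, rfl⟩) (hab ▸ mem_irrefl _)
  · exact h
  · exact absurd ((hπ a (π b)).2 ⟨b, h, rfl⟩) (hab ▸ mem_irrefl _)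

end IsCollapse

theorem exists_isCollapse (hR : WellFounded fun a b => pair a b ∈ R) : ∃ π, IsCollapse R π := by
  refine ⟨hR.fix fun b ih => range fun a : {a // pair a b ∈ R} => ih a a.2, fun b z => ?_⟩
  rw [hR.fix_eq, mem_range, Subtype.exists]
  simp only [exists_prop]

end Collapse

section SetsOfOrdinals

variable {x D E : ZFSet.{u}}

theorem mem_L_of_subset_wellOrder {R A : ZFSet.{u}}
    (hord : ∀ s : ZFSet.{u}, (∀ z ∈ s, z.IsOrdinal) → s ∈ L x) (hD : D ∈ L x) (hR : R ∈ L x)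
    (hwf : WellFounded fun a b => pair a b ∈ R)
    (htrans : ∀ a b c, pair a b ∈ R → pair b c ∈ R → pair a c ∈ R)
    (htri : ∀ a ∈ D, ∀ b ∈ D, pair a b ∈ R ∨ a = b ∨ pair b a ∈ R) (hA : A ⊆ D) : A ∈ L x := by
  obtain ⟨π, hπ⟩ := exists_isCollapse hwf
  obtain ⟨f, hfL, hf, hDf⟩ := exists_isBisimulation_forall_mem hR fun a : D =>
    hπ.exists_isBisimulation_pair_mem hR (mem_L_of_mem hD a.2)
  let s : ZFSet.{u} := range fun a : A => π a
  have hs : s ∈ L x := hord s fun z hz => by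
    obtain ⟨a, rfl⟩ := mem_range.1 hz
    exact hπ.isOrdinal htrans a
  have h : EventuallyDefinable x fun v : Fin 1 → ZFSet.{u} =>
      v 0 ∈ D ∧ ∃ z ∈ s, pair (v 0) z ∈ f :=
    .and (.mem (.var _) (.const hD))
      (.exists_mem (.const hs) (.pair_mem (.var _) (.var _) (.const hfL)))
  refine mem_L_of_eventuallyDefinable (fun a ha => mem_L_of_mem hD (hA ha))
    (h.congr fun v => ⟨fun ha => ?_, ?_⟩)
  · exact ⟨hA ha, π (v 0), mem_range.2 ⟨⟨v 0, ha⟩, rfl⟩, hDf ⟨v 0, hA ha⟩⟩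
  · rintro ⟨hvD, z, hz, hvz⟩
    obtain ⟨a, rfl⟩ := mem_range.1 hz
    exact hπ.injOn htri (hA a.2) hvD (hf.eq_collapse hπ hvz) ▸ a.2

/-- The lexicographic order on `D × D` induced by `∈`. -/
noncomputable def lexRel (D : ZFSet.{u}) : ZFSet.{u} :=
  (prod (prod D D) (prod D D)).sep fun r =>
    ∃ b c d e, r = pair (pair b c) (pair d e) ∧ (b ∈ d ∨ b = d ∧ c ∈ e)

theorem pair_mem_lexRel {p q : ZFSet.{u}} : pair p q ∈ lexRel D ↔
    ∃ b ∈ D, ∃ c ∈ D, ∃ d ∈ D, ∃ e ∈ D,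
      p = pair b c ∧ q = pair d e ∧ (b ∈ d ∨ b = d ∧ c ∈ e) := by
  simp only [lexRel, mem_sep, mem_prod, pair_inj]
  grind [pair_inj]

theorem lexRel_mem_L (hD : D ∈ L x) : lexRel D ∈ L x := by
  have hDD := prod_mem_L hD hD
  have h : EventuallyDefinable x fun v : Fin 1 → ZFSet.{u} =>
      ∃ p ∈ prod D D, ∃ q ∈ prod D D, v 0 = pair p q ∧ ∃ b ∈ D, ∃ c ∈ D, ∃ d ∈ D, ∃ e ∈ D,
        p = pair b c ∧ q = pair d e ∧ (b ∈ d ∨ b = d ∧ c ∈ e) :=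
    .exists_mem (.const hDD) <| .exists_mem (.const hDD) <|
      .and (.eq_pair (.var _) (.var _) (.var _)) <|
      .exists_mem (.const hD) <| .exists_mem (.const hD) <|
      .exists_mem (.const hD) <| .exists_mem (.const hD) <|
      .and (.eq_pair (.var _) (.var _) (.var _)) <| .and (.eq_pair (.var _) (.var _) (.var _)) <|
      .or (.mem (.var _) (.var _)) (.and (.eq (.var _) (.var _)) (.mem (.var _) (.var _)))
  refine mem_L_of_eventuallyDefinable
    (fun r hr => mem_L_of_mem (prod_mem_L hDD hDD) (mem_sep.1 hr).1)
    (h.congr fun v => ⟨fun hv => ?_, ?_⟩)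
  · obtain ⟨p, hp, q, hq, hpq⟩ := mem_prod.1 (mem_sep.1 hv).1
    exact ⟨p, hp, q, hq, hpq, pair_mem_lexRel.1 (hpq ▸ hv)⟩
  · rintro ⟨p, -, q, -, hpq, h⟩
    exact hpq ▸ pair_mem_lexRel.2 h

theorem wellFounded_lexRel (D : ZFSet.{u}) : WellFounded fun p q => pair p q ∈ lexRel D := by
  let unpair : ZFSet.{u} → ZFSet.{u} × ZFSet.{u} := Function.invFun (Function.uncurry pair)
  have hunpair (b c : ZFSet.{u}) : unpair (pair b c) = (b, c) :=
    Function.leftInverse_invFun pair_injective.uncurry (b, c)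
  refine Subrelation.wf (fun {p q} h => ?_) (InvImage.wf unpair (mem_wf.prod_lex mem_wf))
  obtain ⟨b, -, c, -, d, -, e, -, rfl, rfl, hlex⟩ := pair_mem_lexRel.1 h
  simpa only [InvImage, hunpair, Prod.lex_def] using hlex

theorem lexRel_trans (hD : ∀ a ∈ D, a.IsOrdinal) (p q r : ZFSet.{u}) (hpq : pair p q ∈ lexRel D)
    (hqr : pair q r ∈ lexRel D) : pair p r ∈ lexRel D := by
  obtain ⟨b, hb, c, hc, d, -, e, -, rfl, rfl, h⟩ := pair_mem_lexRel.1 hpq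
  obtain ⟨d', -, e', -, k, hk, l, hl, h', rfl, h''⟩ := pair_mem_lexRel.1 hqr
  obtain ⟨rfl, rfl⟩ := pair_inj.1 h'
  have hbdk := (hD k hk).mem_trans (x := b) (y := d)
  have hcel := (hD l hl).mem_trans (x := c) (y := e)
  exact pair_mem_lexRel.2 ⟨b, hb, c, hc, k, hk, l, hl, rfl, rfl, by grind⟩

theorem lexRel_trichotomous (hD : ∀ a ∈ D, a.IsOrdinal) (p : ZFSet.{u}) (hp : p ∈ prod D D)
    (q : ZFSet.{u}) (hq : q ∈ prod D D) :
    pair p q ∈ lexRel D ∨ p = q ∨ pair q p ∈ lexRel D := by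
  obtain ⟨b, hb, c, hc, rfl⟩ := mem_prod.1 hp
  obtain ⟨d, hd, e, he, rfl⟩ := mem_prod.1 hq
  have hbd := (hD b hb).mem_trichotomous (hD d hd)
  have hce := (hD c hc).mem_trichotomous (hD e he)
  simp only [pair_mem_lexRel, pair_inj]
  grind

theorem mem_L_of_subset_prod (hord : ∀ s : ZFSet.{u}, (∀ z ∈ s, z.IsOrdinal) → s ∈ L x)
    (hD : ∀ a ∈ D, a.IsOrdinal) (hE : E ⊆ prod D D) : E ∈ L x := by
  have hDL := hord D hD
  exact mem_L_of_subset_wellOrder hord (prod_mem_L hDL hDL) (lexRel_mem_L hDL)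
    (wellFounded_lexRel D) (lexRel_trans hD) (lexRel_trichotomous hD) hE

theorem exists_injective_isOrdinal (ι : Type*) [Small.{u} ι] :
    ∃ c : ι → ZFSet.{u}, Function.Injective c ∧ ∀ i, (c i).IsOrdinal :=
  ⟨fun i => (embeddingToCardinal (equivShrink ι i)).ord.toZFSet,
    Ordinal.toZFSet_injective.comp (Cardinal.ord_injective.comp
      (embeddingToCardinal.injective.comp (equivShrink ι).injective)),
    fun _ => isOrdinal_toZFSet _⟩

theorem exists_isCollapse_eq (y : ZFSet.{u}) :
    ∃ D E π, (∀ a ∈ D, a.IsOrdinal) ∧ E ⊆ prod D D ∧ IsCollapse E π ∧ ∃ b ∈ D, π b = y := by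
  let t := vonNeumann (Order.succ y.rank)
  obtain ⟨c, hc, hcord⟩ := exists_injective_isOrdinal t
  let D := range c
  let π := Function.extend c (fun z => z.1) fun _ => ∅
  have hπ (z : t) : π (c z) = z := hc.extend_apply _ _ z
  have hcD (z : t) : c z ∈ D := mem_range.2 ⟨z, rfl⟩
  let E := (prod D D).sep fun p => ∃ a b, p = pair a b ∧ π a ∈ π b
  refine ⟨D, E, π, fun a ha => ?_, sep_subset, fun b z => ⟨fun hz => ?_, ?_⟩,
    c ⟨y, mem_vonNeumann_succ y⟩, hcD _, hπ _⟩
  · obtain ⟨z, rfl⟩ := mem_range.1 ha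
    exact hcord z
  · have hb : ∃ w, c w = b := by
      by_contra hb
      have hπb : π b = ∅ := Function.extend_apply' _ _ b hb
      exact notMem_empty z (hπb ▸ hz)
    obtain ⟨w, rfl⟩ := hb
    have hzt : z ∈ t := isTransitive_vonNeumann _ _ w.2 (hπ w ▸ hz)
    have hE : pair (c ⟨z, hzt⟩) (c w) ∈ E :=
      mem_sep.2 ⟨pair_mem_prod.2 ⟨hcD _, hcD w⟩, _, _, rfl, hπ ⟨z, hzt⟩ ▸ hz⟩
    exact ⟨_, hE, hπ _⟩
  · rintro ⟨a, ha, rfl⟩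
    obtain ⟨a', b', h, hab⟩ := (mem_sep.1 ha).2
    obtain ⟨rfl, rfl⟩ := pair_inj.1 h
    exact hab

theorem L_eq_univ_of_forall_isOrdinal
    (hord : ∀ s : ZFSet.{u}, (∀ z ∈ s, z.IsOrdinal) → s ∈ L x) : L x = Set.univ := by
  refine Set.eq_univ_of_forall fun y => ?_
  obtain ⟨D, E, π, hD, hE, hπ, b, hb, rfl⟩ := exists_isCollapse_eq y
  exact hπ.apply_mem_L (mem_L_of_subset_prod hord hD hE) (mem_L_of_mem (hord D hD) hb)

end SetsOfOrdinals

section Sequences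

variable {S zero one x s : ZFSet.{u}}

theorem exists_characteristic_sequence (hzero : zero ∈ S) (hone : one ∈ S) (hne : zero ≠ one)
    (hs : ∀ z ∈ s, z.IsOrdinal) : ∃ w ∈ SeqLtOrd S, ∀ z, pair z one ∈ w ↔ z ∈ s := by
  classical
  let χ (z : ZFSet.{u}) : ZFSet.{u} := if z ∈ s then one else zero
  let : Definable₁ χ := Classical.allZFSetDefinable _
  refine ⟨map χ s.rank.toZFSet, ⟨_, isOrdinal_toZFSet _, map_isFunc.2 fun z _ => ?_⟩, fun z => ?_⟩
  · dsimp only [χ]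
    split_ifs
    exacts [hone, hzero]
  · have hrank : z ∈ s → z ∈ s.rank.toZFSet := fun hz =>
      Ordinal.mem_toZFSet_iff.2 ⟨z.rank, rank_lt_of_mem hz, (hs z hz).toZFSet_rank_eq⟩
    rw [ZFSet.mem_map]
    simp only [pair_inj, χ]
    grind

theorem mem_L_of_seqLtOrd_subset (hzero : zero ∈ S) (hone : one ∈ S) (hne : zero ≠ one)
    (h : SeqLtOrd S ⊆ L x) (hs : ∀ z ∈ s, z.IsOrdinal) : s ∈ L x := by
  obtain ⟨w, hw, hws⟩ := exists_characteristic_sequence hzero hone hne hs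
  have hpair {z : ZFSet.{u}} (hz : z ∈ s) : z ∈ L x ∧ one ∈ L x :=
    mem_L_of_pair_mem (mem_L_of_mem (h hw) ((hws z).2 hz))
  rcases s.eq_empty_or_nonempty with rfl | ⟨z, hz⟩
  · exact empty_mem_L x
  · refine mem_L_of_eventuallyDefinable (fun z hz => (hpair hz).1) ?_
    exact (EventuallyDefinable.pair_mem (.var 0) (.const (hpair hz).2) (.const (h hw))).congr
      fun v => (hws _).symm

end Sequences

end RelConstr

theorem lemma6p5_general {S zero one x : ZFSet.{u}} (hzero : zero ∈ S) (hone : one ∈ S)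
    (hne : zero ≠ one) (h : RelConstr.SeqLtOrd S ⊆ RelConstr.L x) :
    RelConstr.L x = Set.univ :=
  RelConstr.L_eq_univ_of_forall_isOrdinal fun _ hs =>
    RelConstr.mem_L_of_seqLtOrd_subset hzero hone hne h hs

theorem lemma6p5 (S zero one : ZFSet.{u}) (hfin : (S : Set ZFSet.{u}).Finite)
    (hzero : zero ∈ S) (hone : one ∈ S) (hne : zero ≠ one)
    (x : ZFSet.{u}) (hx : ∀ a ∈ x, a.IsOrdinal)
    (h : RelConstr.SeqLtOrd S ⊆ RelConstr.L x) :
    RelConstr.L x = Set.univ :=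
  lemma6p5_general hzero hone hne h
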